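/- Let $X\subset\mathbb{R}^2$ be a nonempty compact convex set that is symmetric, i.e. $X=\frac12\bigl(X\oplus(-X)\bigr)$, where $\oplus$ denotes Minkowski addition. For $\theta\in\mathbb{R}$ let $$H_X(\theta)=h_X(\theta)+h_{-X}(\theta),\qquad h_X(\theta)=\sup_{s\in X}\bigl\langle s,(-\sin\theta,\cos\theta)\bigr\rangle,$$ be the Feret diameter of $X$ (with $H_Y$ defined in the same way for any nonempty compact convex $Y\subset\mathbb{R}^2$), and let $\operatorname{diam}(X)=\sup_{\theta\in\mathbb{R}}H_X(\theta)$. Let $S_\theta=\{s(\cos\theta,\sin\theta): -\frac12\le s\le\frac12\}$. For an integer $N>1$ put $\theta_i=(i-1)\pi/N$, $i=1,\dots,N$, let $$\mathcal{C}^{(N)}_0=\Bigl\{\bigoplus_{i=1}^N\alpha_iS_{\theta_i} : \alpha\in[0,\infty)^N\Bigr\}$$ be the set of $0$-regular zonotopes, let $F^{(N)}=\bigl(|\sin(\theta_i-\theta_j)|\bigr)_{1\le i,j\le N}$, and let $H^{(N)}_X=(H_X(\theta_1),\dots,H_X(\theta_N))^{T}$. Let $d_H$ denote the Hausdorff distance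 for the Euclidean norm. Then: 1. For every $N>1$ the matrix $F^{(N)}$ is invertible, all coordinates of $\alpha=(F^{(N)})^{-1}H^{(N)}_X$ are nonnegative, so that $X_0^{(N)}=\bigoplus_{i=1}^N\alpha_iS_{\theta_i}$ belongs to $\mathcal{C}^{(N)}_0$, and $$d_H\bigl(X,X_0^{(N)}\bigr)\le(6+2\sqrt2)\,\sin\Bigl(\frac{\pi}{2N}\Bigr)\operatorname{diam}(X).$$ Consequently $d_H(X,X_0^{(N)})\to0$ as $N\to\infty$. 2. For every $N>1$, $X_0^{(N)}$ is the unique element of $\mathcal{C}^{(N)}_0$ satisfying $H_{X_0^{(N)}}(\theta_i)=H_X(\theta_i)$ for $i=1,\dots,N$. 3. For every $N>1$, $X\subseteq X_0^{(N)}$ and $$X_0^{(N)}=\bigcap_{i=1}^N\Bigl\{x\in\mathbb{R}^2 : \bigl|\bigl\langle x,(-\sin\theta_i,\cos\theta_i)\bigr\rangle\bigr|\le\tfrac12H_X(\theta_i)\Bigr\}.$$ -/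

import Mathlib

open scoped Pointwise

noncomputable section

namespace Feret

/-- The Euclidean plane. -/
abbrev Plane : Type := EuclideanSpace ℝ (Fin 2)

/-- The class of symmetric convex bodies of the plane: nonempty compact convex sets that are
symmetric in the sense of Minkowski, `X = (1/2) (X ⊕ (-X))`. No interior points are required. -/
def symmetricBodies : Set (Set Plane) :=
  {X | X.Nonempty ∧ IsCompact X ∧ Convex ℝ X ∧ X = (1 / 2 : ℝ) • (X + -X)}

/-- The support function `f_X(x) = sup_{s ∈ X} ⟨x, s⟩`. -/
def supportFun (X : Set Plane) (x : Plane) : ℝ :=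
  sSup ((fun s : Plane => inner ℝ x s) '' X)

/-- The unit vector `(cos t, sin t)`. -/
def dir (t : ℝ) : Plane := !₂[Real.cos t, Real.sin t]

/-- The unit vector `(-sin t, cos t)`, normal to `dir t`. -/
def normal (t : ℝ) : Plane := !₂[-Real.sin t, Real.cos t]

/-- The support function in angular form, `h_X(t) = f_X(-sin t, cos t)`. -/
def angularSupport (X : Set Plane) (t : ℝ) : ℝ := supportFun X (normal t)

/-- The Feret diameter `H_X(t) = h_X(t) + h_{-X}(t)`. -/
def feret (X : Set Plane) (t : ℝ) : ℝ := angularSupport X t + angularSupport (-X) t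

/-- The maximal diameter `diam X = sup_t H_X(t)`. -/
def maxDiam (X : Set Plane) : ℝ := ⨆ t : ℝ, feret X t

/-- The unit line segment centred at the origin with direction `dir t`. -/
def unitSegment (t : ℝ) : Set Plane :=
  (fun s : ℝ => s • dir t) '' Set.Icc (-(1 / 2)) (1 / 2)

/-- The angles of the regular subdivision of `[0, π)` into `N` parts, indexed from `0`. -/
def angle (N : ℕ) (i : Fin N) : ℝ := (i : ℝ) * Real.pi / (N : ℝ)

/-- The Minkowski sum of the segments `α i • unitSegment (angle N i)`. -/
def minkowskiSum (N : ℕ) (α : Fin N → ℝ) : Set Plane :=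
  ∑ i, α i • unitSegment (angle N i)

/-- The class of `0`-regular zonotopes with at most `2N` faces. -/
def regularZonotopes (N : ℕ) : Set (Set Plane) :=
  {Y | ∃ α : Fin N → ℝ, (∀ i, 0 ≤ α i) ∧ Y = minkowskiSum N α}

/-- The matrix `F = (|sin (θ_i - θ_j)|)`. -/
def sinMatrix (N : ℕ) : Matrix (Fin N) (Fin N) ℝ :=
  Matrix.of fun i j => |Real.sin (angle N i - angle N j)|

/-- The vector of the Feret diameters of `X` at the regular angles. -/
def feretVector (N : ℕ) (X : Set Plane) : Fin N → ℝ := fun i => feret X (angle N i)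

/-- The face length vector `F⁻¹ H_X`. -/
def faceLengths (N : ℕ) (X : Set Plane) : Fin N → ℝ :=
  Matrix.mulVec (sinMatrix N)⁻¹ (feretVector N X)

/-- The approximation of `X` with face length vector `F⁻¹ H_X`. -/
def approx (N : ℕ) (X : Set Plane) : Set Plane := minkowskiSum N (faceLengths N X)

end Feret

end

namespace Feret

/-! ### Support functions -/

/-! Put d = π/N. A zonotope with face lengths α ≥ 0 has Feret diameter t ↦ ∑ αⱼ|sin(t - θⱼ)|, so
matching X at the regular angles is the linear system Fα = H_X. The second difference f(t+d) +
f(t-d) - 2 cos d · f(t) kills every sinusoid and sees |sin(· - θⱼ)| only at its kink θⱼ, where it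
equals 2 sin d (`abs_sin_second_difference`). This inverts F explicitly, using π-periodicity at the
two ends; the second difference of H_X is nonnegative because the support function is sublinear and
n(t+d) + n(t-d) = 2 cos d · n(t) for the normals n.

Between consecutive regular angles, n(t) is a nonnegative combination of the two end normals. The
strips therefore bound ⟨n(t), x⟩ by an interpolation of h_X, and the support function of the
zonotope equals that interpolation. By separation the zonotope is the intersection of the strips,
which contains X.

For the distance, the interpolation is compared with h_X itself, which is Lipschitz in the normal
with constant diam(X)/2. This gives the constant 3, better than 6 + 2√2. -/

theorem bddAbove_inner_image {X : Set Plane} (hX : IsCompact X) (x : Plane) :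
    BddAbove ((fun s : Plane => inner ℝ x s) '' X) :=
  (hX.image (by fun_prop)).bddAbove

theorem inner_le_supportFun {X : Set Plane} (hX : IsCompact X) {s : Plane} (hs : s ∈ X)
    (x : Plane) : inner ℝ x s ≤ supportFun X x :=
  le_csSup (bddAbove_inner_image hX x) ⟨s, hs, rfl⟩

theorem supportFun_le {X : Set Plane} (hX : X.Nonempty) {x : Plane} {c : ℝ}
    (h : ∀ s ∈ X, inner ℝ x s ≤ c) : supportFun X x ≤ c := by
  apply csSup_le (hX.image _)
  rintro _ ⟨s, hs, rfl⟩
  exact h s hs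

theorem supportFun_add_le {X : Set Plane} (hne : X.Nonempty) (hX : IsCompact X) (x y : Plane) :
    supportFun X (x + y) ≤ supportFun X x + supportFun X y := by
  refine supportFun_le hne fun s hs => ?_
  rw [inner_add_left]
  exact add_le_add (inner_le_supportFun hX hs x) (inner_le_supportFun hX hs y)

theorem supportFun_smul_le {X : Set Plane} (hne : X.Nonempty) (hX : IsCompact X) {c : ℝ}
    (hc : 0 ≤ c) (x : Plane) : supportFun X (c • x) ≤ c * supportFun X x := by
  refine supportFun_le hne fun s hs => ?_
  rw [real_inner_smul_left]
  exact mul_le_mul_of_nonneg_left (inner_le_supportFun hX hs x) hc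

theorem supportFun_smul {X : Set Plane} (hne : X.Nonempty) (hX : IsCompact X) {c : ℝ}
    (hc : 0 < c) (x : Plane) : supportFun X (c • x) = c * supportFun X x := by
  refine le_antisymm (supportFun_smul_le hne hX hc.le x) ?_
  have h := supportFun_smul_le hne hX (inv_nonneg.2 hc.le) (c • x)
  rw [smul_smul, inv_mul_cancel₀ hc.ne', one_smul] at h
  calc c * supportFun X x ≤ c * (c⁻¹ * supportFun X (c • x)) := by gcongr
    _ = _ := by field_simp

theorem supportFun_neg_set (X : Set Plane) (x : Plane) :
    supportFun (-X) x = supportFun X (-x) := by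
  unfold supportFun
  congr 1
  ext c
  constructor
  · rintro ⟨s, hs, rfl⟩
    exact ⟨-s, hs, by simp⟩
  · rintro ⟨s, hs, rfl⟩
    exact ⟨-s, by simpa using hs, by simp⟩

theorem supportFun_add_set {A B : Set Plane} (hA : A.Nonempty) (hA' : IsCompact A)
    (hB : B.Nonempty) (hB' : IsCompact B) (x : Plane) :
    supportFun (A + B) x = supportFun A x + supportFun B x := by
  unfold supportFun
  rw [← csSup_add (hA.image _) (bddAbove_inner_image hA' x) (hB.image _)
    (bddAbove_inner_image hB' x)]
  congr 1
  exact Set.image_add (innerSL ℝ x)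

/-- Cauchy–Schwarz applied to ⟨x - y, s⟩. The error estimate uses it with R = `maxDiam X / 2`. -/
theorem supportFun_le_add_norm_mul {X : Set Plane} (hne : X.Nonempty) (hX : IsCompact X) {R : ℝ}
    (hR : ∀ s ∈ X, ‖s‖ ≤ R) (x y : Plane) :
    supportFun X x ≤ supportFun X y + ‖x - y‖ * R := by
  refine supportFun_le hne fun s hs => ?_
  have h1 : inner ℝ x s = inner ℝ y s + inner ℝ (x - y) s := by rw [inner_sub_left]; ring
  have h2 := real_inner_le_norm (x - y) s
  have h3 := mul_le_mul_of_nonneg_left (hR s hs) (norm_nonneg (x - y))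
  linarith [inner_le_supportFun hX hs y]

/-- A bound on the support function excess in all unit directions bounds the distance. -/
theorem infDist_le_of_inner_le {K : Set Plane} (hne : K.Nonempty) (hK : IsCompact K)
    (hc : Convex ℝ K) {x : Plane} {r : ℝ} (hr : 0 ≤ r)
    (h : ∀ u : Plane, ‖u‖ = 1 → inner ℝ u x ≤ supportFun K u + r) :
    Metric.infDist x K ≤ r := by
  obtain ⟨p, hp, hmin⟩ := exists_norm_eq_iInf_of_complete_convex hne hK.isComplete hc x
  have hp' := (norm_eq_iInf_iff_real_inner_le_zero hc hp).1 hmin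
  refine (Metric.infDist_le_dist_of_mem hp).trans ?_
  rw [dist_eq_norm]
  rcases eq_or_ne (x - p) 0 with h0 | h0
  · simpa [h0] using hr
  have hpos : 0 < ‖x - p‖ := norm_pos_iff.2 h0
  -- The vector from the nearest point p to x is an outer normal at p, so in this direction the
  -- support function of K is attained at p and the excess is exactly the distance.
  have h1 := h (‖x - p‖⁻¹ • (x - p)) (by
    rw [norm_smul, norm_inv, norm_norm, inv_mul_cancel₀ hpos.ne'])
  have h2 : supportFun K (x - p) ≤ inner ℝ (x - p) p := supportFun_le hne fun s hs => by
    have := hp' s hs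
    rw [inner_sub_right] at this
    linarith
  rw [supportFun_smul hne hK (inv_pos.2 hpos), real_inner_smul_left] at h1
  have h3 : inner ℝ (x - p) x = inner ℝ (x - p) p + ‖x - p‖ ^ 2 := by
    rw [← real_inner_self_eq_norm_sq, ← inner_add_right]
    simp
  have h4 : ‖x - p‖⁻¹ * ‖x - p‖ ^ 2 = ‖x - p‖ := by field_simp
  have h5 := mul_le_mul_of_nonneg_left h2 (inv_nonneg.2 hpos.le)
  rw [h3, mul_add, h4] at h1
  linarith

/-! ### Directions -/

theorem inner_normal_dir (t s : ℝ) : inner ℝ (normal t) (dir s) = -Real.sin (t - s) := by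
  simp [normal, dir, PiLp.inner_apply, Fin.sum_univ_two, Real.sin_sub]
  ring

theorem norm_normal (t : ℝ) : ‖normal t‖ = 1 := by
  simp [normal, EuclideanSpace.norm_eq, Fin.sum_univ_two]

theorem normal_add_pi (t : ℝ) : normal (t + Real.pi) = -normal t := by
  ext i; fin_cases i <;> simp [normal]

theorem normal_add_normal (t d : ℝ) :
    normal (t + d) + normal (t - d) = (2 * Real.cos d) • normal t := by
  ext i; fin_cases i <;> simp [normal, Real.sin_add, Real.sin_sub, Real.cos_add, Real.cos_sub] <;>
    ring

/-- Three-term interpolation relation for sinusoids; `sin_add_smul_normal` is its vector form. -/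
theorem sin_add_mul_sin (p q x : ℝ) :
    Real.sin (p + q) * Real.sin x =
      Real.sin q * Real.sin (x - p) + Real.sin p * Real.sin (x + q) := by
  rw [Real.sin_add, Real.sin_sub, Real.sin_add]
  ring

theorem sin_add_smul_normal (p q t : ℝ) :
    Real.sin (p + q) • normal t =
      Real.sin q • normal (t - p) + Real.sin p • normal (t + q) := by
  ext i; fin_cases i <;> simp [normal, Real.sin_add, Real.sin_sub, Real.cos_add, Real.cos_sub] <;>
    ring

/-- The chord of an arc of length |s - t| is 2 sin(|s - t|/2), increasing up to π. -/
theorem norm_normal_sub_normal_le {s t d : ℝ} (h : |s - t| ≤ d) (hd : d ≤ Real.pi) :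
    ‖normal s - normal t‖ ≤ 2 * Real.sin (d / 2) := by
  have hd0 : 0 ≤ d := (abs_nonneg _).trans h
  have hs0 : 0 ≤ Real.sin (d / 2) := Real.sin_nonneg_of_nonneg_of_le_pi (by linarith) (by linarith)
  have h1 : ‖normal s - normal t‖ ^ 2 = 2 - 2 * Real.cos |s - t| := by
    rw [norm_sub_sq_real, norm_normal, norm_normal, Real.cos_abs, Real.cos_sub]
    simp [normal, PiLp.inner_apply, Fin.sum_univ_two]
    ring
  have h2 : Real.cos d ≤ Real.cos |s - t| :=
    Real.cos_le_cos_of_nonneg_of_le_pi (abs_nonneg _) hd h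
  have h3 : Real.cos d = 1 - 2 * Real.sin (d / 2) ^ 2 := by
    have := Real.cos_two_mul (d / 2)
    rw [mul_div_cancel₀ d two_ne_zero] at this
    linarith [Real.sin_sq_add_cos_sq (d / 2)]
  refine (pow_le_pow_iff_left₀ (norm_nonneg _) (by positivity) two_ne_zero).1 ?_
  linarith

/-- Allowing a sign confines t to [0, π], which suffices because the support functions involved are
even. -/
theorem exists_eq_normal_or_neg {u : Plane} (hu : ‖u‖ = 1) :
    ∃ t, 0 ≤ t ∧ t ≤ Real.pi ∧ (u = normal t ∨ u = -normal t) := by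
  have h1 : u 0 ^ 2 + u 1 ^ 2 = 1 := by
    have := EuclideanSpace.norm_sq_eq u
    simpa [hu, Fin.sum_univ_two] using this.symm
  have key : ∀ a b : ℝ, a ^ 2 + b ^ 2 = 1 → a ≤ 0 → -Real.sin (Real.arccos b) = a := by
    intro a b h ha
    rw [Real.sin_arccos, show 1 - b ^ 2 = (-a) ^ 2 by linarith, Real.sqrt_sq (by linarith)]
    ring
  have hb : -1 ≤ u 1 ∧ u 1 ≤ 1 := by constructor <;> nlinarith [sq_nonneg (u 0)]
  rcases le_total (u 0) 0 with h0 | h0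
  · refine ⟨Real.arccos (u 1), Real.arccos_nonneg _, Real.arccos_le_pi _, Or.inl ?_⟩
    ext i; fin_cases i
    · simpa [normal] using (key _ _ h1 h0).symm
    · simp [normal, Real.cos_arccos hb.1 hb.2]
  · refine ⟨Real.arccos (-u 1), Real.arccos_nonneg _, Real.arccos_le_pi _, Or.inr ?_⟩
    ext i; fin_cases i
    · have := key (-u 0) (-u 1) (by linarith) (by linarith)
      simp only [normal]
      simp
      linarith
    · simp [normal, Real.cos_arccos (by linarith : -1 ≤ -u 1) (by linarith)]

/-! ### Regular angles -/

theorem pi_div_pos {N : ℕ} (hN : 1 < N) : 0 < Real.pi / N := by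
  have : (0 : ℝ) < N := by exact_mod_cast (by omega : 0 < N)
  have := Real.pi_pos
  positivity

theorem pi_div_le {N : ℕ} (hN : 1 < N) : Real.pi / N ≤ Real.pi / 2 := by
  have : (2 : ℝ) ≤ N := by exact_mod_cast hN
  have := Real.pi_pos
  gcongr

theorem sin_pi_div_pos {N : ℕ} (hN : 1 < N) : 0 < Real.sin (Real.pi / N) :=
  Real.sin_pos_of_pos_of_lt_pi (pi_div_pos hN) (by linarith [pi_div_le hN, Real.pi_pos])

theorem natCast_mul_pi_div {N : ℕ} (hN : 1 < N) : (N : ℝ) * (Real.pi / N) = Real.pi := by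
  have : (N : ℝ) ≠ 0 := by exact_mod_cast (by omega : N ≠ 0)
  field_simp

theorem angle_eq (N : ℕ) (i : Fin N) : angle N i = (i : ℝ) * (Real.pi / N) := by
  unfold angle; ring

theorem abs_sin_of_mem {x : ℝ} (h0 : 0 ≤ x) (h1 : x ≤ Real.pi) : |Real.sin x| = Real.sin x :=
  abs_of_nonneg (Real.sin_nonneg_of_nonneg_of_le_pi h0 h1)

theorem abs_sin_of_neg_mem {x : ℝ} (h0 : x ≤ 0) (h1 : -Real.pi ≤ x) :
    |Real.sin x| = -Real.sin x :=
  abs_of_nonpos (Real.sin_nonpos_of_nonpos_of_neg_pi_le h0 h1)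

/-- Between consecutive multiples of `π / N` the sine relative to a regular angle keeps its
sign. -/
theorem exists_sign_abs_sin {N : ℕ} (hN : 1 < N) {k : ℕ} (hk : k < N) (j : Fin N) :
    ∃ ε : ℝ, ∀ t, k * (Real.pi / N) ≤ t → t ≤ (k + 1) * (Real.pi / N) →
      |Real.sin (t - angle N j)| = ε * Real.sin (t - angle N j) := by
  have hd := pi_div_pos hN
  have hNd := natCast_mul_pi_div hN
  rw [angle_eq]
  set d := Real.pi / N
  -- The angle θⱼ is never interior to the sector, so t - θⱼ stays in [0, π] or in [-π, 0].
  rcases le_or_gt (j : ℕ) k with hjk | hjk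
  · refine ⟨1, fun t h1 h2 => ?_⟩
    have a1 : (j : ℝ) * d ≤ k * d := by
      have : (j : ℝ) ≤ k := by exact_mod_cast hjk
      gcongr
    have a2 : ((k : ℝ) + 1) * d ≤ N * d := by
      have : (k : ℝ) + 1 ≤ N := by exact_mod_cast hk
      gcongr
    have a3 : 0 ≤ (j : ℝ) * d := by positivity
    rw [abs_sin_of_mem (by linarith) (by linarith), one_mul]
  · refine ⟨-1, fun t h1 h2 => ?_⟩
    have a1 : ((k : ℝ) + 1) * d ≤ j * d := by
      have : (k : ℝ) + 1 ≤ j := by exact_mod_cast hjk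
      gcongr
    have a2 : (j : ℝ) * d ≤ N * d := by
      have : (j : ℝ) ≤ N := by exact_mod_cast j.2.le
      gcongr
    have a3 : 0 ≤ (k : ℝ) * d := by positivity
    rw [abs_sin_of_neg_mem (by linarith) (by linarith), neg_one_mul]

theorem sin_mul_abs_sin_sub_angle {N : ℕ} (hN : 1 < N) {k : ℕ} (hk : k < N) (j : Fin N)
    {p q : ℝ} (hp : 0 ≤ p) (hq : 0 ≤ q) (hpq : p + q = Real.pi / N) :
    Real.sin (Real.pi / N) * |Real.sin (k * (Real.pi / N) + p - angle N j)| =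
      Real.sin q * |Real.sin (k * (Real.pi / N) - angle N j)| +
        Real.sin p * |Real.sin ((k + 1) * (Real.pi / N) - angle N j)| := by
  obtain ⟨ε, hε⟩ := exists_sign_abs_sin hN hk j
  have hd := pi_div_pos hN
  rw [hε _ (by linarith) (by linarith), hε _ le_rfl (by linarith),
    hε _ (by linarith) le_rfl, ← hpq]
  have h := sin_add_mul_sin p q (k * (p + q) + p - angle N j)
  rw [show k * (p + q) + p - angle N j - p = k * (p + q) - angle N j by ring,
    show k * (p + q) + p - angle N j + q = (k + 1) * (p + q) - angle N j by ring] at h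
  linear_combination ε * h

theorem abs_sin_second_difference {N : ℕ} (hN : 1 < N) (i j : Fin N) :
    |Real.sin (angle N i + Real.pi / N - angle N j)| +
      |Real.sin (angle N i - Real.pi / N - angle N j)| -
      2 * Real.cos (Real.pi / N) * |Real.sin (angle N i - angle N j)| =
      if i = j then 2 * Real.sin (Real.pi / N) else 0 := by
  have hd := pi_div_pos hN
  have hs := sin_pi_div_pos hN
  have hNd := natCast_mul_pi_div hN
  have hid : ∀ x : ℝ, Real.sin (x + Real.pi / N) + Real.sin (x - Real.pi / N) =
      2 * Real.cos (Real.pi / N) * Real.sin x := by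
    intro x; rw [Real.sin_add, Real.sin_sub]; ring
  split_ifs with hij
  · subst hij
    simp only [sub_self, add_sub_cancel_left, Real.sin_zero, abs_zero]
    rw [show angle N i - Real.pi / N - angle N i = -(Real.pi / N) by ring, Real.sin_neg, abs_neg,
      abs_of_pos hs]
    ring
  rw [angle_eq, angle_eq]
  rw [show (i : ℝ) * (Real.pi / N) + Real.pi / N - j * (Real.pi / N) =
      (i - j) * (Real.pi / N) + Real.pi / N by ring,
    show (i : ℝ) * (Real.pi / N) - Real.pi / N - j * (Real.pi / N) =
      (i - j) * (Real.pi / N) - Real.pi / N by ring,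
    show (i : ℝ) * (Real.pi / N) - j * (Real.pi / N) = (i - j) * (Real.pi / N) by ring]
  have hx := hid ((i - j) * (Real.pi / N))
  set d := Real.pi / N
  -- For i ≠ j all three arguments stay in [-π, 0] or in [0, π], so the absolute values share one
  -- sign and `hid` applies.
  rcases lt_or_gt_of_ne (fun h => hij (Fin.ext h) : (i : ℕ) ≠ j) with h | h
  · have a1 : ((i : ℝ) - j) * d ≤ (-1) * d := by
      have : (i : ℝ) + 1 ≤ j := by exact_mod_cast h
      gcongr; linarith
    have a2 : -(N * d) + d ≤ ((i : ℝ) - j) * d := by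
      have : (j : ℝ) + 1 ≤ N := by exact_mod_cast j.2
      have : (-N + 1 : ℝ) * d ≤ ((i : ℝ) - j) * d := by
        gcongr
        linarith [(Nat.cast_nonneg (i : ℕ) : (0 : ℝ) ≤ (i : ℕ))]
      linarith
    rw [abs_sin_of_neg_mem (by linarith) (by linarith),
      abs_sin_of_neg_mem (by linarith) (by linarith),
      abs_sin_of_neg_mem (by linarith) (by linarith)]
    linarith
  · have a1 : 1 * d ≤ ((i : ℝ) - j) * d := by
      have : (j : ℝ) + 1 ≤ i := by exact_mod_cast h
      gcongr; linarith
    have a2 : ((i : ℝ) - j) * d ≤ N * d - d := by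
      have : (i : ℝ) + 1 ≤ N := by exact_mod_cast i.2
      have : ((i : ℝ) - j) * d ≤ (N - 1 : ℝ) * d := by
        refine mul_le_mul_of_nonneg_right ?_ hd.le
        linarith [(Nat.cast_nonneg (j : ℕ) : (0 : ℝ) ≤ (j : ℕ))]
      linarith
    rw [abs_sin_of_mem (by linarith) (by linarith),
      abs_sin_of_mem (by linarith) (by linarith),
      abs_sin_of_mem (by linarith) (by linarith)]
    linarith

/-- Every angle of `[0, π]` lies between consecutive multiples of `π / N`. -/
theorem exists_sector {N : ℕ} (hN : 1 < N) {t : ℝ} (h0 : 0 ≤ t) (h1 : t ≤ Real.pi) :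
    ∃ k < N, ∃ p q : ℝ, 0 ≤ p ∧ 0 ≤ q ∧ p + q = Real.pi / N ∧ t = k * (Real.pi / N) + p := by
  have hd := pi_div_pos hN
  have hNd := natCast_mul_pi_div hN
  set d := Real.pi / N
  rcases h0.eq_or_lt with rfl | h0
  · exact ⟨0, by omega, 0, d, le_rfl, hd.le, by simp, by simp⟩
  -- The ceiling, rather than the floor, puts t = π in the last sector k = N - 1; t = 0 had to be
  -- treated apart.
  have hc : 0 < ⌈t / d⌉₊ := Nat.ceil_pos.2 (by positivity)
  have hc' : ⌈t / d⌉₊ ≤ N := Nat.ceil_le.2 ((div_le_iff₀ hd).2 (by linarith))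
  obtain ⟨k, hk⟩ : ∃ k, ⌈t / d⌉₊ = k + 1 := ⟨_, (Nat.succ_pred_eq_of_pos hc).symm⟩
  have hle : t ≤ (k + 1) * d := by
    have := Nat.le_ceil (t / d)
    rw [hk, div_le_iff₀ hd] at this
    exact_mod_cast this
  have hlt : k * d < t := (lt_div_iff₀ hd).1 (Nat.lt_ceil.1 (by omega))
  exact ⟨k, by omega, t - k * d, (k + 1) * d - t, by linarith, by linarith, by ring, by ring⟩

/-! ### Zonotopes -/

theorem smul_unitSegment_nonempty (a t : ℝ) : (a • unitSegment t).Nonempty :=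
  ((Set.nonempty_Icc.2 (by norm_num)).image _).smul_set

theorem isCompact_smul_unitSegment (a t : ℝ) : IsCompact (a • unitSegment t) :=
  (isCompact_Icc.image (by fun_prop)).smul a

theorem convex_smul_unitSegment (a t : ℝ) : Convex ℝ (a • unitSegment t) :=
  ((convex_Icc _ _).is_linear_image ⟨fun x y => add_smul x y _, fun c x => mul_smul c x _⟩).smul a

theorem supportFun_smul_unitSegment {a : ℝ} (ha : 0 ≤ a) (t : ℝ) (x : Plane) :
    supportFun (a • unitSegment t) x = a * |inner ℝ x (dir t)| / 2 := by
  apply le_antisymm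
  · apply supportFun_le (smul_unitSegment_nonempty a t)
    rintro _ ⟨_, ⟨s, hs, rfl⟩, rfl⟩
    simp only [real_inner_smul_right]
    have h1 : s * inner ℝ x (dir t) ≤ 1 / 2 * |inner ℝ x (dir t)| := by
      refine (le_abs_self _).trans ?_
      rw [abs_mul]
      gcongr
      exact abs_le.2 hs
    have := mul_le_mul_of_nonneg_left h1 ha
    linarith
  · have hmem : ∀ s ∈ Set.Icc (-(1 / 2) : ℝ) (1 / 2),
        a * (s * inner ℝ x (dir t)) ≤ supportFun (a • unitSegment t) x := fun s hs => by
      have := inner_le_supportFun (isCompact_smul_unitSegment a t)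
        (Set.smul_mem_smul_set ⟨s, hs, rfl⟩) x
      simpa only [real_inner_smul_right] using this
    rcases abs_cases (inner ℝ x (dir t)) with ⟨h, -⟩ | ⟨h, -⟩ <;> rw [h]
    · linarith [hmem (1 / 2) (by norm_num)]
    · linarith [hmem (-(1 / 2)) (by norm_num)]

section Zonotope

variable {N : ℕ} {α : Fin N → ℝ}

theorem minkowskiSum_nonempty (N : ℕ) (α : Fin N → ℝ) : (minkowskiSum N α).Nonempty :=
  Finset.sum_induction _ Set.Nonempty (fun _ _ => Set.Nonempty.add) Set.zero_nonempty
    fun _ _ => smul_unitSegment_nonempty _ _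

theorem isCompact_minkowskiSum (N : ℕ) (α : Fin N → ℝ) : IsCompact (minkowskiSum N α) :=
  Finset.sum_induction _ IsCompact (fun _ _ => IsCompact.add) isCompact_singleton
    fun _ _ => isCompact_smul_unitSegment _ _

theorem convex_minkowskiSum (N : ℕ) (α : Fin N → ℝ) : Convex ℝ (minkowskiSum N α) :=
  Finset.sum_induction _ (Convex ℝ) (fun _ _ => Convex.add) (convex_singleton 0)
    fun _ _ => convex_smul_unitSegment _ _

theorem supportFun_minkowskiSum (hα : ∀ i, 0 ≤ α i) (x : Plane) :
    supportFun (minkowskiSum N α) x = ∑ i, α i * |inner ℝ x (dir (angle N i))| / 2 := by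
  -- Nonemptiness and compactness travel with the induction because additivity of support functions
  -- needs them.
  have key : ∀ s : Finset (Fin N),
      (∑ i ∈ s, α i • unitSegment (angle N i)).Nonempty ∧
      IsCompact (∑ i ∈ s, α i • unitSegment (angle N i)) ∧
      supportFun (∑ i ∈ s, α i • unitSegment (angle N i)) x =
        ∑ i ∈ s, α i * |inner ℝ x (dir (angle N i))| / 2 := by
    intro s
    induction s using Finset.induction_on with
    | empty =>
      exact ⟨Set.zero_nonempty, isCompact_singleton, by
        simp [supportFun, ← Set.singleton_zero]⟩
    | insert i s hi ih =>
      have h1 := smul_unitSegment_nonempty (α i) (angle N i)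
      have h2 := isCompact_smul_unitSegment (α i) (angle N i)
      rw [Finset.sum_insert hi, Finset.sum_insert hi]
      refine ⟨h1.add ih.1, h2.add ih.2.1, ?_⟩
      rw [supportFun_add_set h1 h2 ih.1 ih.2.1, ih.2.2, supportFun_smul_unitSegment (hα i)]
  exact (key Finset.univ).2.2

theorem angularSupport_minkowskiSum (hα : ∀ i, 0 ≤ α i) (t : ℝ) :
    angularSupport (minkowskiSum N α) t = (∑ i, α i * |Real.sin (t - angle N i)|) / 2 := by
  simp only [angularSupport, supportFun_minkowskiSum hα, inner_normal_dir, abs_neg,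
    Finset.sum_div]

theorem feret_minkowskiSum (hα : ∀ i, 0 ≤ α i) (t : ℝ) :
    feret (minkowskiSum N α) t = ∑ i, α i * |Real.sin (t - angle N i)| := by
  have h : angularSupport (-minkowskiSum N α) t = angularSupport (minkowskiSum N α) t := by
    simp only [angularSupport, supportFun_neg_set, supportFun_minkowskiSum hα, inner_neg_left,
      abs_neg]
  rw [feret, h, angularSupport_minkowskiSum hα]
  ring

end Zonotope

/-! ### The sine matrix -/

section SinMatrix

variable {N : ℕ}

theorem sinMatrix_mulVec (v : Fin N → ℝ) (i : Fin N) :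
    (sinMatrix N).mulVec v i = ∑ j, v j * |Real.sin (angle N i - angle N j)| := by
  simp [Matrix.mulVec, dotProduct, sinMatrix, mul_comm]

theorem sum_abs_sin_add_pi (v : Fin N → ℝ) (t : ℝ) :
    ∑ j, v j * |Real.sin (t + Real.pi - angle N j)| =
      ∑ j, v j * |Real.sin (t - angle N j)| := by
  refine Finset.sum_congr rfl fun j _ => ?_
  rw [show t + Real.pi - angle N j = t - angle N j + Real.pi by ring, Real.sin_add_pi, abs_neg]

theorem sum_abs_sin_second_difference (hN : 1 < N) (v : Fin N → ℝ) (i : Fin N) :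
    ∑ j, v j * |Real.sin (angle N i + Real.pi / N - angle N j)| +
      ∑ j, v j * |Real.sin (angle N i - Real.pi / N - angle N j)| -
      2 * Real.cos (Real.pi / N) * ∑ j, v j * |Real.sin (angle N i - angle N j)| =
      2 * Real.sin (Real.pi / N) * v i := by
  rw [Finset.mul_sum, ← Finset.sum_add_distrib, ← Finset.sum_sub_distrib]
  calc _ = ∑ j, v j * (if i = j then 2 * Real.sin (Real.pi / N) else 0) := by
        refine Finset.sum_congr rfl fun j _ => ?_
        rw [← abs_sin_second_difference hN]
        ring
    _ = _ := by simp [mul_comm]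

/-- Two `π`-periodic functions that agree at the regular angles agree at their neighbours. -/
theorem eq_at_neighbours (hN : 1 < N) {f g : ℝ → ℝ} (hf : Function.Periodic f Real.pi)
    (hg : Function.Periodic g Real.pi) (h : ∀ i, f (angle N i) = g (angle N i)) (i : Fin N) :
    f (angle N i + Real.pi / N) = g (angle N i + Real.pi / N) ∧
      f (angle N i - Real.pi / N) = g (angle N i - Real.pi / N) := by
  have hNd := natCast_mul_pi_div hN
  constructor
  · by_cases hi : (i : ℕ) + 1 < N
    · have := h ⟨i + 1, hi⟩
      rwa [show angle N ⟨i + 1, hi⟩ = angle N i + Real.pi / N by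
        rw [angle_eq, angle_eq]; push_cast; ring] at this
    -- Here i = N - 1 and the right neighbour is π, identified with the angle 0 by periodicity.
    · have := h ⟨0, by omega⟩
      have hi' : ((i : ℕ) : ℝ) + 1 = N := by
        exact_mod_cast (by have := i.2; omega : (i : ℕ) + 1 = N)
      rw [← hf, ← hg] at this
      rwa [show angle N ⟨0, by omega⟩ + Real.pi = angle N i + Real.pi / N by
        rw [angle_eq, angle_eq]
        push_cast
        linear_combination -hNd - (Real.pi / N) * hi'] at this
  · by_cases hi : (i : ℕ) = 0
    -- The left neighbour of 0 is -π/N, which a shift by π carries to the last regular angle.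
    · have := h ⟨N - 1, by omega⟩
      rw [← hf (_ - _), ← hg (_ - _)]
      rwa [show angle N ⟨N - 1, by omega⟩ = angle N i - Real.pi / N + Real.pi by
        rw [angle_eq, angle_eq, hi]
        push_cast [Nat.cast_sub hN.le]
        linear_combination hNd] at this
    · have := h ⟨i - 1, by omega⟩
      rwa [show angle N ⟨i - 1, by omega⟩ = angle N i - Real.pi / N by
        rw [angle_eq, angle_eq]
        push_cast [Nat.cast_sub (by omega : 1 ≤ (i : ℕ))]
        ring] at this

/-- Solutions of the linear system are given by second differences of the right-hand side. -/
theorem two_mul_sin_mul_eq_of_mulVec_eq (hN : 1 < N) {v : Fin N → ℝ} {f : ℝ → ℝ}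
    (hf : Function.Periodic f Real.pi)
    (h : ∀ i, (sinMatrix N).mulVec v i = f (angle N i)) (i : Fin N) :
    2 * Real.sin (Real.pi / N) * v i =
      f (angle N i + Real.pi / N) + f (angle N i - Real.pi / N) -
        2 * Real.cos (Real.pi / N) * f (angle N i) := by
  have h' : ∀ i, ∑ j, v j * |Real.sin (angle N i - angle N j)| = f (angle N i) := fun i => by
    rw [← sinMatrix_mulVec, h]
  have hn := eq_at_neighbours hN (f := fun t => ∑ j, v j * |Real.sin (t - angle N j)|) (g := f)
    (sum_abs_sin_add_pi v) hf h' i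
  rw [← sum_abs_sin_second_difference hN, ← hn.1, ← hn.2, ← h']

theorem isUnit_sinMatrix (hN : 1 < N) : IsUnit (sinMatrix N) := by
  rw [← Matrix.mulVec_injective_iff_isUnit]
  intro v w hvw
  funext i
  -- A kernel vector solves the system with right-hand side f = 0, so its second differences vanish.
  have h := two_mul_sin_mul_eq_of_mulVec_eq hN (v := v - w) (f := fun _ => 0) (fun _ => rfl)
    (fun i => by rw [Matrix.mulVec_sub, hvw, sub_self, Pi.zero_apply]) i
  have hs := sin_pi_div_pos hN
  simp only [add_zero, mul_zero, sub_zero, mul_eq_zero, Pi.sub_apply] at h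
  rcases h with (h | h) | h
  · norm_num at h
  · exact absurd h hs.ne'
  · linarith

theorem sinMatrix_mulVec_faceLengths (hN : 1 < N) (X : Set Plane) :
    (sinMatrix N).mulVec (faceLengths N X) = feretVector N X := by
  rw [faceLengths, Matrix.mulVec_mulVec, Matrix.mul_nonsing_inv, Matrix.one_mulVec]
  exact (Matrix.isUnit_iff_isUnit_det _).1 (isUnit_sinMatrix hN)

theorem eq_faceLengths (hN : 1 < N) {X : Set Plane} {v : Fin N → ℝ}
    (hv : (sinMatrix N).mulVec v = feretVector N X) : v = faceLengths N X :=
  Matrix.mulVec_injective_iff_isUnit.2 (isUnit_sinMatrix hN)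
    (hv.trans (sinMatrix_mulVec_faceLengths hN X).symm)

end SinMatrix

/-! ### Symmetric bodies -/

section Symmetric

variable {N : ℕ} {X : Set Plane}

theorem neg_eq_of_mem_symmetricBodies (hX : X ∈ symmetricBodies) : -X = X := by
  have h := hX.2.2.2
  calc -X = -((1 / 2 : ℝ) • (X + -X)) := by rw [← h]
    _ = (1 / 2 : ℝ) • (X + -X) := by rw [← Set.smul_set_neg, neg_add, neg_neg, add_comm]
    _ = X := h.symm

theorem supportFun_neg (hX : X ∈ symmetricBodies) (x : Plane) :
    supportFun X (-x) = supportFun X x := by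
  rw [← supportFun_neg_set, neg_eq_of_mem_symmetricBodies hX]

theorem feret_eq (hX : X ∈ symmetricBodies) (t : ℝ) :
    feret X t = 2 * supportFun X (normal t) := by
  rw [feret, neg_eq_of_mem_symmetricBodies hX, angularSupport]
  ring

theorem feret_periodic (hX : X ∈ symmetricBodies) : Function.Periodic (feret X) Real.pi := by
  intro t
  rw [feret_eq hX, feret_eq hX, normal_add_pi, supportFun_neg hX]

theorem abs_inner_le_supportFun (hX : X ∈ symmetricBodies) {s : Plane} (hs : s ∈ X) (x : Plane) :
    |inner ℝ x s| ≤ supportFun X x := by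
  refine abs_le.2 ⟨?_, inner_le_supportFun hX.2.1 hs x⟩
  have := inner_le_supportFun hX.2.1 hs (-x)
  rw [supportFun_neg hX, inner_neg_left] at this
  linarith

/-- X contains both s and -s, so its width in the direction of s is at least 2‖s‖. -/
theorem norm_le_maxDiam (hX : X ∈ symmetricBodies) {s : Plane} (hs : s ∈ X) :
    ‖s‖ ≤ maxDiam X / 2 := by
  obtain ⟨R, hR⟩ := hX.2.1.isBounded.exists_norm_le
  -- Without this bound the real supremum would take its default value 0.
  have hbdd : BddAbove (Set.range (feret X)) := by
    refine ⟨2 * R, ?_⟩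
    rintro _ ⟨t, rfl⟩
    rw [feret_eq hX]
    have : supportFun X (normal t) ≤ R := supportFun_le hX.1 fun s hs => by
      have := real_inner_le_norm (normal t) s
      rw [norm_normal, one_mul] at this
      exact this.trans (hR s hs)
    linarith
  have hle : ∀ t, supportFun X (normal t) ≤ maxDiam X / 2 := fun t => by
    have := le_ciSup hbdd t
    rw [feret_eq hX] at this
    unfold maxDiam
    linarith
  rcases eq_or_ne s 0 with rfl | h0
  · have := abs_inner_le_supportFun hX hs (normal 0)
    rw [norm_zero]
    exact (abs_nonneg _).trans (this.trans (hle 0))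
  have hpos : 0 < ‖s‖ := norm_pos_iff.2 h0
  obtain ⟨t, -, -, ht⟩ := exists_eq_normal_or_neg (u := ‖s‖⁻¹ • s) (by
    rw [norm_smul, norm_inv, norm_norm, inv_mul_cancel₀ hpos.ne'])
  have h1 : inner ℝ (‖s‖⁻¹ • s) s = ‖s‖ := by
    rw [real_inner_smul_left, real_inner_self_eq_norm_sq]
    field_simp
  have h2 := abs_inner_le_supportFun hX hs (normal t)
  refine le_trans ?_ (h2.trans (hle t))
  rcases ht with ht | ht
  · rw [← h1, ht]; exact le_abs_self _
  · rw [← h1, ht, inner_neg_left]; exact neg_le_abs _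

/-- The face length is a positive multiple of a second difference of `feret X`, nonnegative by
subadditivity applied to `normal_add_normal`. -/
theorem faceLengths_nonneg (hN : 1 < N) (hX : X ∈ symmetricBodies) (i : Fin N) :
    0 ≤ faceLengths N X i := by
  have h := two_mul_sin_mul_eq_of_mulVec_eq hN (feret_periodic hX)
    (fun i => congrFun (sinMatrix_mulVec_faceLengths hN X) i) i
  have hs := sin_pi_div_pos hN
  have hd := pi_div_pos hN
  have hc : 0 ≤ Real.cos (Real.pi / N) :=
    Real.cos_nonneg_of_mem_Icc ⟨by linarith [Real.pi_pos], pi_div_le hN⟩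
  have h1 := supportFun_add_le hX.1 hX.2.1 (normal (angle N i + Real.pi / N))
    (normal (angle N i - Real.pi / N))
  have h2 : 2 * Real.cos (Real.pi / N) * supportFun X (normal (angle N i)) ≤
      supportFun X (normal (angle N i + Real.pi / N) + normal (angle N i - Real.pi / N)) := by
    rw [normal_add_normal]
    -- The cosine vanishes when N = 2; homogeneity is available only for positive factors, so that
    -- case is reduced to nonnegativity of the support function at 0.
    rcases hc.eq_or_lt with hc | hc
    · obtain ⟨s, hs⟩ := hX.1
      rw [← hc]
      simpa using abs_inner_le_supportFun hX hs ((2 * (0 : ℝ)) • normal (angle N i))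
    · exact (supportFun_smul hX.1 hX.2.1 (by positivity) _).ge
  rw [feret_eq hX, feret_eq hX, feret_eq hX] at h
  refine nonneg_of_mul_nonneg_right (b := faceLengths N X i)
    (a := 2 * Real.sin (Real.pi / N)) ?_ (by positivity)
  linarith

theorem feret_approx_angle (hN : 1 < N) (hX : X ∈ symmetricBodies) (i : Fin N) :
    feret (approx N X) (angle N i) = feret X (angle N i) := by
  rw [approx, feret_minkowskiSum (faceLengths_nonneg hN hX), ← sinMatrix_mulVec,
    sinMatrix_mulVec_faceLengths hN, feretVector]

theorem eq_approx_of_feret_eq (hN : 1 < N) {Y : Set Plane} (hY : Y ∈ regularZonotopes N)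
    (h : ∀ i : Fin N, feret Y (angle N i) = feret X (angle N i)) : Y = approx N X := by
  obtain ⟨α, hα, rfl⟩ := hY
  rw [approx, ← eq_faceLengths hN (v := α)]
  funext i
  rw [sinMatrix_mulVec, ← feret_minkowskiSum hα, h, feretVector]

/-- The intersection of the strips supporting `X` at the regular angles. -/
def stripIntersection (N : ℕ) (X : Set Plane) : Set Plane :=
  ⋂ i : Fin N, {x : Plane | |inner ℝ x (normal (angle N i))| ≤ (1 / 2) * feret X (angle N i)}

theorem abs_inner_normal_le_of_mem (hX : X ∈ symmetricBodies) (hN : 1 < N) {x : Plane}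
    (hx : x ∈ stripIntersection N X) {k : ℕ} (hk : k ≤ N) :
    |inner ℝ (normal (k * (Real.pi / N))) x| ≤ supportFun X (normal (k * (Real.pi / N))) := by
  have h : ∀ i : Fin N, |inner ℝ (normal (angle N i)) x| ≤ supportFun X (normal (angle N i)) := by
    intro i
    have := Set.mem_iInter.1 hx i
    rw [Set.mem_ofPred_eq, feret_eq hX, real_inner_comm] at this
    linarith
  rcases hk.lt_or_eq with hk | rfl
  · have := h ⟨k, hk⟩
    rwa [angle_eq] at this
  -- The case k = N, right end of the last sector: the normal at π is minus the normal at 0.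
  · have := h ⟨0, by omega⟩
    rw [angle_eq, Nat.cast_zero, zero_mul] at this
    rw [natCast_mul_pi_div hN, ← zero_add Real.pi, normal_add_pi, supportFun_neg hX,
      inner_neg_left, abs_neg]
    exact this

/-- The support function of the intersection of strips between consecutive regular angles. -/
theorem sin_mul_abs_inner_normal_le (hX : X ∈ symmetricBodies) (hN : 1 < N) {x : Plane}
    (hx : x ∈ stripIntersection N X) {k : ℕ} (hk : k < N) {p q : ℝ} (hp : 0 ≤ p) (hq : 0 ≤ q)
    (hpq : p + q = Real.pi / N) :
    Real.sin (Real.pi / N) * |inner ℝ (normal (k * (Real.pi / N) + p)) x| ≤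
      Real.sin q * supportFun X (normal (k * (Real.pi / N))) +
        Real.sin p * supportFun X (normal ((k + 1) * (Real.pi / N))) := by
  have hd := pi_div_le hN
  have hpi := Real.pi_pos
  have hsp : 0 ≤ Real.sin p := Real.sin_nonneg_of_nonneg_of_le_pi hp (by linarith)
  have hsq : 0 ≤ Real.sin q := Real.sin_nonneg_of_nonneg_of_le_pi hq (by linarith)
  have h1 := abs_inner_normal_le_of_mem hX hN hx hk.le
  have h2 := abs_inner_normal_le_of_mem hX hN hx (Nat.succ_le_of_lt hk)
  push_cast at h2
  have h3 := sin_add_smul_normal p q (k * (Real.pi / N) + p)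
  rw [add_sub_cancel_right, add_assoc, hpq,
    show (k : ℝ) * (Real.pi / N) + Real.pi / N = (k + 1) * (Real.pi / N) by ring] at h3
  have h4 := congrArg (fun y => inner ℝ y x) h3
  simp only [inner_add_left, real_inner_smul_left] at h4
  rw [← abs_of_pos (sin_pi_div_pos hN), ← abs_mul, h4]
  refine (abs_add_le _ _).trans ?_
  rw [abs_mul, abs_mul, abs_of_nonneg hsp, abs_of_nonneg hsq]
  gcongr

theorem subset_stripIntersection (hX : X ∈ symmetricBodies) : X ⊆ stripIntersection N X := by
  intro s hs
  refine Set.mem_iInter.2 fun i => ?_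
  have := abs_inner_le_supportFun hX hs (normal (angle N i))
  rw [Set.mem_ofPred_eq, feret_eq hX, real_inner_comm]
  linarith

theorem supportFun_approx_normal (hN : 1 < N) (hX : X ∈ symmetricBodies) {k : ℕ} (hk : k ≤ N) :
    supportFun (approx N X) (normal (k * (Real.pi / N))) =
      supportFun X (normal (k * (Real.pi / N))) := by
  have hf : ∀ t, feret (approx N X) t = 2 * supportFun (approx N X) (normal t) := fun t => by
    have := angularSupport_minkowskiSum (faceLengths_nonneg hN hX) t
    rw [approx, feret_minkowskiSum (faceLengths_nonneg hN hX), ← angularSupport, this]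
    ring
  have hper : Function.Periodic (feret (approx N X)) Real.pi := fun t => by
    rw [approx, feret_minkowskiSum (faceLengths_nonneg hN hX),
      feret_minkowskiSum (faceLengths_nonneg hN hX), sum_abs_sin_add_pi]
  have key : feret (approx N X) (k * (Real.pi / N)) = feret X (k * (Real.pi / N)) := by
    rcases hk.lt_or_eq with hk | rfl
    · have := feret_approx_angle hN hX ⟨k, hk⟩
      rwa [angle_eq] at this
    · have := feret_approx_angle hN hX ⟨0, by omega⟩
      rw [angle_eq, Nat.cast_zero, zero_mul] at this
      rw [natCast_mul_pi_div hN, ← zero_add Real.pi, hper, feret_periodic hX, this]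
  rw [hf, feret_eq hX] at key
  linarith

/-- The zonotope lies in the strips because its support function agrees with that of X at the
regular normals. The converse compares support functions sector by sector, then separates. -/
theorem approx_eq_stripIntersection (hN : 1 < N) (hX : X ∈ symmetricBodies) :
    approx N X = stripIntersection N X := by
  have hα := faceLengths_nonneg hN hX
  have hcomp : IsCompact (approx N X) := isCompact_minkowskiSum N _
  have hne : (approx N X).Nonempty := minkowskiSum_nonempty N _
  have hneg : ∀ x, supportFun (approx N X) (-x) = supportFun (approx N X) x := fun x => by
    simp only [approx, supportFun_minkowskiSum hα, inner_neg_left, abs_neg]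
  apply Set.Subset.antisymm
  · intro x hx
    refine Set.mem_iInter.2 fun i => ?_
    have h1 := inner_le_supportFun hcomp hx (normal (angle N i))
    have h2 := inner_le_supportFun hcomp hx (-normal (angle N i))
    rw [hneg, inner_neg_left] at h2
    have h3 := supportFun_approx_normal hN hX i.2.le
    rw [← angle_eq] at h3
    rw [Set.mem_ofPred_eq, feret_eq hX, real_inner_comm, ← h3]
    exact abs_le.2 ⟨by linarith, by linarith⟩
  · intro x hx
    have key : ∀ u : Plane, ‖u‖ = 1 → inner ℝ u x ≤ supportFun (approx N X) u + 0 := by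
      intro u hu
      obtain ⟨t, h0, h1, ht⟩ := exists_eq_normal_or_neg hu
      obtain ⟨k, hk, p, q, hp, hq, hpq, rfl⟩ := exists_sector hN h0 h1
      have hle := sin_mul_abs_inner_normal_le hX hN hx hk hp hq hpq
      -- No kink of the support function is interior to a sector, so interpolation is exact for the
      -- zonotope, while it is only an upper bound for points of the strips.
      have hP : Real.sin (Real.pi / N) * angularSupport (approx N X) (k * (Real.pi / N) + p) =
          Real.sin q * angularSupport (approx N X) (k * (Real.pi / N)) +
          Real.sin p * angularSupport (approx N X) ((k + 1) * (Real.pi / N)) := by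
        simp only [approx, angularSupport_minkowskiSum hα, Finset.sum_div, Finset.mul_sum,
          ← Finset.sum_add_distrib]
        refine Finset.sum_congr rfl fun j _ => ?_
        linear_combination (faceLengths N X j / 2) * sin_mul_abs_sin_sub_angle hN hk j hp hq hpq
      have e1 := supportFun_approx_normal hN hX hk.le
      have e2 := supportFun_approx_normal hN hX (Nat.succ_le_of_lt hk)
      push_cast at e2
      simp only [angularSupport] at hP
      rw [e1, e2] at hP
      rw [← hP] at hle
      have hle' := le_of_mul_le_mul_left hle (sin_pi_div_pos hN)
      rw [add_zero]
      rcases ht with rfl | rfl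
      · exact (le_abs_self _).trans hle'
      · rw [hneg, inner_neg_left]
        exact (neg_le_abs _).trans hle'
    have h := infDist_le_of_inner_le hne hcomp (convex_minkowskiSum N _) le_rfl key
    exact (hcomp.isClosed.mem_iff_infDist_zero hne).2 (le_antisymm h Metric.infDist_nonneg)

/-! ### The error estimate and convergence -/

theorem infDist_le_of_mem_stripIntersection (hX : X ∈ symmetricBodies) (hN : 1 < N) {x : Plane}
    (hx : x ∈ stripIntersection N X) :
    Metric.infDist x X ≤ 3 * Real.sin (Real.pi / (2 * N)) * maxDiam X := by
  have hd0 := pi_div_pos hN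
  have hd := pi_div_le hN
  have hpi := Real.pi_pos
  have hN0 : (N : ℝ) ≠ 0 := by exact_mod_cast (by omega : N ≠ 0)
  have hhalf : Real.pi / (2 * N) = Real.pi / N / 2 := by field_simp
  have hss := sin_pi_div_pos hN
  have hs0 : 0 ≤ Real.sin (Real.pi / N / 2) :=
    Real.sin_nonneg_of_nonneg_of_le_pi (by linarith) (by linarith)
  -- The half-angle is at most π/4; the cruder bound by π/3 is enough for the constant 3.
  have hc : 1 / 2 ≤ Real.cos (Real.pi / N / 2) := by
    rw [← Real.cos_pi_div_three]
    exact Real.cos_le_cos_of_nonneg_of_le_pi (by linarith) (by linarith) (by linarith)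
  have hc1 := Real.cos_le_one (Real.pi / N / 2)
  have hsd : Real.sin (Real.pi / N) =
      2 * Real.sin (Real.pi / N / 2) * Real.cos (Real.pi / N / 2) := by
    rw [← Real.sin_two_mul, mul_div_cancel₀ _ two_ne_zero]
  have hsc := Real.sin_sq_add_cos_sq (Real.pi / N / 2)
  obtain ⟨s₀, hs₀⟩ := hX.1
  have hD : 0 ≤ maxDiam X / 2 := (norm_nonneg s₀).trans (norm_le_maxDiam hX hs₀)
  rw [hhalf]
  refine infDist_le_of_inner_le hX.1 hX.2.1 hX.2.2.1
    (mul_nonneg (by positivity) (by linarith)) fun u hu => ?_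
  obtain ⟨t, h0, h1, ht⟩ := exists_eq_normal_or_neg hu
  obtain ⟨k, hk, p, q, hp, hq, hpq, rfl⟩ := exists_sector hN h0 h1
  have hle := sin_mul_abs_inner_normal_le hX hN hx hk hp hq hpq
  have hsp : 0 ≤ Real.sin p := Real.sin_nonneg_of_nonneg_of_le_pi hp (by linarith)
  have hsq : 0 ≤ Real.sin q := Real.sin_nonneg_of_nonneg_of_le_pi hq (by linarith)
  have hlip : ∀ r, |r - (k * (Real.pi / N) + p)| ≤ Real.pi / N → supportFun X (normal r) ≤
      supportFun X (normal (k * (Real.pi / N) + p)) +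
        2 * Real.sin (Real.pi / N / 2) * (maxDiam X / 2) := fun r hr => by
    refine (supportFun_le_add_norm_mul hX.1 hX.2.1 (fun s hs => norm_le_maxDiam hX hs) _
      (normal (k * (Real.pi / N) + p))).trans ?_
    gcongr
    exact norm_normal_sub_normal_le hr (by linarith)
  have l1 := hlip (k * (Real.pi / N)) (abs_le.2 ⟨by linarith, by linarith⟩)
  have l2 := hlip ((k + 1) * (Real.pi / N)) (abs_le.2 ⟨by linarith, by linarith⟩)
  have hh : supportFun X (normal (k * (Real.pi / N) + p)) ≤ maxDiam X / 2 :=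
    supportFun_le hX.1 fun s hs => by
      have := real_inner_le_norm (normal (k * (Real.pi / N) + p)) s
      rw [norm_normal, one_mul] at this
      exact this.trans (norm_le_maxDiam hX hs)
  have hh0 : 0 ≤ supportFun X (normal (k * (Real.pi / N) + p)) :=
    (abs_nonneg _).trans (abs_inner_le_supportFun hX hs₀ _)
  have hsum : Real.sin p + Real.sin q ≤ 2 * Real.sin (Real.pi / N / 2) := by
    have h := Real.cos_le_one ((p - q) / 2)
    have e1 : Real.sin p + Real.sin q =
        2 * Real.sin (Real.pi / N / 2) * Real.cos ((p - q) / 2) := by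
      have ep := Real.sin_add ((p + q) / 2) ((p - q) / 2)
      have eq := Real.sin_sub ((p + q) / 2) ((p - q) / 2)
      rw [show (p + q) / 2 + (p - q) / 2 = p by ring] at ep
      rw [show (p + q) / 2 - (p - q) / 2 = q by ring] at eq
      rw [← hpq, ep, eq]
      ring
    rw [e1]
    nlinarith
  have habs : inner ℝ u x - supportFun X u ≤
      |inner ℝ (normal (k * (Real.pi / N) + p)) x| -
        supportFun X (normal (k * (Real.pi / N) + p)) := by
    rcases ht with rfl | rfl
    · linarith [le_abs_self (inner ℝ (normal (k * (Real.pi / N) + p)) x)]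
    · rw [supportFun_neg hX, inner_neg_left]
      linarith [neg_le_abs (inner ℝ (normal (k * (Real.pi / N) + p)) x)]
  have hspos : 0 < Real.sin (Real.pi / N / 2) := by
    refine hs0.lt_of_ne fun h => ?_
    rw [hsd, ← h] at hss
    simp at hss
  set σ := Real.sin (Real.pi / N / 2)
  set c := Real.cos (Real.pi / N / 2)
  set h := supportFun X (normal (k * (Real.pi / N) + p))
  set A := |inner ℝ (normal (k * (Real.pi / N) + p)) x|
  set D := maxDiam X / 2 with hDdef
  -- Both end values of the support function are at most h + 2σD, and the weights satisfy sin p +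
  -- sin q ≤ 2σ.
  have m1 : 2 * σ * c * A ≤ 2 * σ * (h + 2 * σ * D) := by
    rw [← hsd]
    calc _ ≤ _ := hle
      _ ≤ Real.sin q * (h + 2 * σ * D) + Real.sin p * (h + 2 * σ * D) := by gcongr
      _ = (Real.sin p + Real.sin q) * (h + 2 * σ * D) := by ring
      _ ≤ _ := by gcongr
  have m2 : c * A ≤ h + 2 * σ * D :=
    le_of_mul_le_mul_left (by linarith) (by positivity : 0 < 2 * σ)
  -- Since 0 ≤ c ≤ 1, (1 - c)² ≤ (1 - c)(1 + c) = σ².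
  have m3 : 1 - c ≤ σ := by nlinarith
  have m4 : c * (A - h) ≤ 3 * σ * D := by
    have : (1 - c) * h ≤ σ * D := mul_le_mul m3 hh hh0 hs0
    linarith
  -- Dividing by c ≥ 1/2 doubles the 3; as D is half the diameter, the final constant is 3 again.
  have m5 : A - h ≤ 6 * σ * D := by
    have h6 : 0 ≤ σ * D := mul_nonneg hs0 hD
    by_contra! hcon
    nlinarith
  have : maxDiam X = 2 * D := by rw [hDdef]; ring
  rw [this]
  linarith

/-- X lies in the approximation, so only the distance from its points to X counts, and 3 ≤ 6 + 2√2.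
-/
theorem hausdorffDist_approx_le (hN : 1 < N) (hX : X ∈ symmetricBodies) :
    Metric.hausdorffDist X (approx N X) ≤
      (6 + 2 * Real.sqrt 2) * Real.sin (Real.pi / (2 * (N : ℝ))) * maxDiam X := by
  have hpi := Real.pi_pos
  have hN1 : (1 : ℝ) < N := by exact_mod_cast hN
  have hs : 0 ≤ Real.sin (Real.pi / (2 * N)) := by
    refine Real.sin_nonneg_of_nonneg_of_le_pi (by positivity) (div_le_self hpi.le (by linarith))
  obtain ⟨s₀, hs₀⟩ := hX.1
  have hD : 0 ≤ maxDiam X := by linarith [(norm_nonneg s₀).trans (norm_le_maxDiam hX hs₀)]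
  refine Metric.hausdorffDist_le_of_infDist (by positivity) (fun x hx => ?_) fun x hx => ?_
  · rw [Metric.infDist_zero_of_mem]
    · positivity
    · rw [approx_eq_stripIntersection hN hX]
      exact subset_stripIntersection hX hx
  · rw [approx_eq_stripIntersection hN hX] at hx
    refine (infDist_le_of_mem_stripIntersection hX hN hx).trans ?_
    gcongr
    linarith [Real.sqrt_nonneg 2]

theorem tendsto_hausdorffDist_approx (hX : X ∈ symmetricBodies) :
    Filter.Tendsto (fun N : ℕ => Metric.hausdorffDist X (approx N X)) Filter.atTop (nhds 0) := by
  have h1 : Filter.Tendsto (fun N : ℕ => Real.pi / (2 * (N : ℝ))) Filter.atTop (nhds 0) :=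
    Filter.Tendsto.const_div_atTop
      (tendsto_natCast_atTop_atTop.const_mul_atTop two_pos) _
  have h2 := ((Real.continuous_sin.tendsto 0).comp h1).const_mul (6 + 2 * Real.sqrt 2)
  have h3 := h2.mul_const (maxDiam X)
  rw [Real.sin_zero, mul_zero, zero_mul] at h3
  refine tendsto_of_tendsto_of_tendsto_of_le_of_le' tendsto_const_nhds h3
    (Filter.Eventually.of_forall fun _ => Metric.hausdorffDist_nonneg) ?_
  filter_upwards [Filter.eventually_gt_atTop 1] with N hN
  exact hausdorffDist_approx_le hN hX

end Symmetric

end Feret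

theorem mainTheorem1 (X : Set Feret.Plane) (hX : X ∈ Feret.symmetricBodies) :
    (∀ N : ℕ, 1 < N →
      IsUnit (Feret.sinMatrix N) ∧
      (∀ i, 0 ≤ Feret.faceLengths N X i) ∧
      Feret.approx N X ∈ Feret.regularZonotopes N ∧
      Metric.hausdorffDist X (Feret.approx N X) ≤
        (6 + 2 * Real.sqrt 2) * Real.sin (Real.pi / (2 * (N : ℝ))) * Feret.maxDiam X) ∧
    Filter.Tendsto (fun N : ℕ => Metric.hausdorffDist X (Feret.approx N X))
      Filter.atTop (nhds 0) ∧
    (∀ N : ℕ, 1 < N →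
      (∀ i : Fin N, Feret.feret (Feret.approx N X) (Feret.angle N i) =
        Feret.feret X (Feret.angle N i)) ∧
      (∀ Y ∈ Feret.regularZonotopes N,
        (∀ i : Fin N, Feret.feret Y (Feret.angle N i) = Feret.feret X (Feret.angle N i)) →
        Y = Feret.approx N X)) ∧
    (∀ N : ℕ, 1 < N →
      X ⊆ Feret.approx N X ∧
      Feret.approx N X =
        ⋂ i : Fin N, {x : Feret.Plane | |inner ℝ x (Feret.normal (Feret.angle N i))| ≤
          (1 / 2) * Feret.feret X (Feret.angle N i)}) := by
  exact ⟨fun N hN => ⟨Feret.isUnit_sinMatrix hN, Feret.faceLengths_nonneg hN hX,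
      ⟨_, Feret.faceLengths_nonneg hN hX, rfl⟩, Feret.hausdorffDist_approx_le hN hX⟩,
    Feret.tendsto_hausdorffDist_approx hX,
    fun N hN => ⟨Feret.feret_approx_angle hN hX,
      fun Y hY h => Feret.eq_approx_of_feret_eq hN hY h⟩,
    fun N hN => ⟨by
      rw [Feret.approx_eq_stripIntersection hN hX]
      exact Feret.subset_stripIntersection hX, Feret.approx_eq_stripIntersection hN hX⟩⟩
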